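/- Let $X\subset\mathbb R^2\simeq\mathbb C$ be a bounded domain (a nonempty, bounded, open and connected set; for instance a bounded Lipschitz domain of finite connectivity), let $|X|$ be its area, and let $2\le p<\infty$. Let $\mathscr H^p(X,X)$ be the class of orientation-preserving homeomorphisms $h$ of $X$ onto $X$ that belong to the Sobolev space $\mathscr W^{1,p}(X,\mathbb C)$. For such $h$ let $Dh$ be its weak derivative (a $2\times2$ matrix at almost every point), $|Dh|$ the Hilbert–Schmidt norm of $Dh$, and $$\mathsf E_1^p[h]=\int_X\Big(|Dh(x)|^p+\frac1{\det Dh(x)}\Big)\,dx\in[0,\infty],$$ where $1/\det Dh$ is read as $+\infty$ at points where $\det Dh\le 0$. Then the identity map $\mathrm{Id}$ of $X$ belongs to $\mathscr H^p(X,X)$ and minimizes $\mathsf E_1^p$ over $\mathscr H^p(X,X)$. Moreover, $$\mathsf E_1^p[h]\ \ge\ \big(2^{p/2}+1\big)\,|X|\ =\ \mathsf E_1^p[\mathrm{Id}]\qquad\text{for all } h\in\mathscr H^p(X,X).$$ -/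

import Mathlib

open MeasureTheory Set
open scoped ContDiff ENNReal

/-- The planar domains under consideration: nonempty, bounded, open and connected subsets of
`ℂ ≃ ℝ²`. -/
structure IsBoundedDomain (X : Set ℂ) : Prop where
  isOpen : IsOpen X
  isConnected : IsConnected X
  isBounded : Bornology.IsBounded X

/-- `G` is a weak (distributional) derivative of `h` on the open set `X ⊆ ℂ ≃ ℝ²`: both are
locally integrable on `X`, and for every test function `φ ∈ C_c^∞(X)` and every direction `v`,
`∫_X (∂_v φ) h = - ∫_X φ (G v)`. -/
def IsWeakDeriv (X : Set ℂ) (h : ℂ → ℂ) (G : ℂ → ℂ →L[ℝ] ℂ) : Prop :=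
  LocallyIntegrableOn h X ∧ LocallyIntegrableOn G X ∧
    ∀ φ : ℂ → ℝ, ContDiff ℝ ∞ φ → HasCompactSupport φ → tsupport φ ⊆ X →
      ∀ v : ℂ, ∫ z in X, (fderiv ℝ φ z v) • h z = - ∫ z in X, φ z • G z v

/-- Membership in the Sobolev class `W^{1,p}(X, ℂ)`. -/
def MemSobolev (p : ℝ) (X : Set ℂ) (h : ℂ → ℂ) : Prop :=
  MemLp h (ENNReal.ofReal p) (volume.restrict X) ∧
    ∃ G : ℂ → ℂ →L[ℝ] ℂ, IsWeakDeriv X h G ∧ MemLp G (ENNReal.ofReal p) (volume.restrict X)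

open Classical in
/-- The deformation gradient `Dh` on `X`: the weak derivative of `h`, which is unique up to a null
subset of `X` (and `0` if `h` has no weak derivative on `X`). -/
noncomputable def weakDeriv (X : Set ℂ) (h : ℂ → ℂ) : ℂ → ℂ →L[ℝ] ℂ :=
  if H : ∃ G : ℂ → ℂ →L[ℝ] ℂ, IsWeakDeriv X h G then H.choose else 0

/-- The Hilbert-Schmidt norm of a real-linear map of the plane; `1, i` is an orthonormal basis. -/
noncomputable def hsNorm (L : ℂ →L[ℝ] ℂ) : ℝ :=
  Real.sqrt (‖L 1‖ ^ 2 + ‖L Complex.I‖ ^ 2)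

/-- The neohookean energy `∫_X (|Dh|^p + (det Dh)^{-q})`, with values in `[0, ∞]`; the second term
is `+∞` where `det Dh` is not positive. -/
noncomputable def neohookeanEnergy (p q : ℝ) (X : Set ℂ) (h : ℂ → ℂ) : ℝ≥0∞ :=
  ∫⁻ z in X, (ENNReal.ofReal (hsNorm (weakDeriv X h z) ^ p) +
    (ENNReal.ofReal (weakDeriv X h z).det ^ q)⁻¹)

/-- The closed curve `γ : [0, 2π] → ℂ` has winding number `1` around `0`: a continuous branch `θ`
of the argument along `γ` exists and increases by `2π`. -/
def WindsOnce (γ : ℝ → ℂ) : Prop :=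
  (∀ t ∈ Icc 0 (2 * Real.pi), γ t ≠ 0) ∧
    ∃ θ : ℝ → ℝ, ContinuousOn θ (Icc 0 (2 * Real.pi)) ∧
      (∀ t ∈ Icc 0 (2 * Real.pi), γ t = ‖γ t‖ * Complex.exp (θ t * Complex.I)) ∧
      θ (2 * Real.pi) = θ 0 + 2 * Real.pi

/-- `h` restricts to a homeomorphism of `X` onto `Y`. -/
def IsHomeoOnto (X Y : Set ℂ) (h : ℂ → ℂ) : Prop :=
  ∃ e : X ≃ₜ Y, ∀ x : X, (e x : ℂ) = h x

/-- A homeomorphism `h` of the open set `X` preserves orientation: the image of the positively oriented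
boundary of each closed disk in `X` winds once, in the positive direction, around the image of the
centre. -/
def PreservesOrientation (X : Set ℂ) (h : ℂ → ℂ) : Prop :=
  ∀ z : ℂ, ∀ r : ℝ, 0 < r → Metric.closedBall z r ⊆ X →
    WindsOnce fun t => h (circleMap z r t) - h z

/-- The class `H^p(X, Y)` of orientation-preserving homeomorphisms of `X` onto `Y` that belong to
`W^{1,p}(X, ℂ)`. -/
def SobolevHomeo (p : ℝ) (X Y : Set ℂ) : Set (ℂ → ℂ) :=
  {h | IsHomeoOnto X Y h ∧ PreservesOrientation X h ∧ MemSobolev p X h}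

/-! Write J = det Dh. Since |Dh|² ≥ 2|J|, where J > 0 the energy density is at least 2^(p/2) J^(p/2)
+ 1/J, a convex function of J, hence at least its tangent line at J = 1. That line has positive
slope a = 2^(p/2)·p/2 − 1, so integration gives E[h] ≥ (2^(p/2) + 1)|X| + a(∫|J| − |X|). It remains
to know the area inequality |h(X)| ≤ ∫_X |J|, because h(X) = X; for the identity the bound is
attained.

The area inequality (`PreservesOrientation.volume_image_le`) is proved by mollification. A
winding-number argument (`WindsOnce.exists_eq_zero`) shows that each value of h is taken by all
sufficiently fine mollifications, for which the smooth area inequality is available. The Jacobians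
pass to the limit by Fatou's lemma applied to |D|² − |det D| ≥ 0, since mollification does not
increase ∫|Dh|²; this is where p ≥ 2 enters the area inequality. -/

/-! ### Winding numbers and existence of zeros. -/

/-- A zero-free continuous function on a closed disk has a continuous logarithm. -/
theorem exists_continuous_exp_eq {z : ℂ} {r : ℝ} (hr : 0 < r) {g : ℂ → ℂ}
    (hg : ContinuousOn g (Metric.closedBall z r)) (h0 : ∀ w ∈ Metric.closedBall z r, g w ≠ 0) :
    ∃ L : ℂ → ℂ, Continuous L ∧ ∀ w ∈ Metric.closedBall z r, Complex.exp (L w) = g w := by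
  -- `R` is the radial retraction onto the disk; `g ∘ R` is zero-free on the simply connected plane,
  -- so it lifts through the covering `exp`.
  let R : ℂ → ℂ := fun w => z + ((r / max r ‖w - z‖ : ℝ) : ℂ) * (w - z)
  have hpos (w : ℂ) : 0 < max r ‖w - z‖ := lt_max_of_lt_left hr
  have hRc : Continuous R := by
    have : Continuous fun w : ℂ => r / max r ‖w - z‖ :=
      continuous_const.div (by fun_prop) fun w => (hpos w).ne'
    fun_prop
  have hRm (w : ℂ) : R w ∈ Metric.closedBall z r := by
    rw [mem_closedBall_iff_norm]
    simp only [R, add_sub_cancel_left, norm_mul, Complex.norm_real, Real.norm_eq_abs]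
    rw [abs_of_pos (div_pos hr (hpos w)), div_mul_eq_mul_div, div_le_iff₀ (hpos w)]
    exact mul_le_mul_of_nonneg_left (le_max_right _ _) hr.le
  have hRe (w : ℂ) (hw : w ∈ Metric.closedBall z r) : R w = w := by
    rw [mem_closedBall_iff_norm] at hw
    simp [R, max_eq_left hw, hr.ne']
  let f : C(ℂ, ℂ) := ⟨fun w => g (R w), hg.comp_continuous hRc hRm⟩
  obtain ⟨F, ⟨-, hF⟩, -⟩ := Complex.isCoveringMapOn_exp.existsUnique_continuousMap_lifts f
    (a₀ := z) (e₀ := Complex.log (f z)) (Complex.exp_log (h0 _ (hRm z))) (fun a => h0 _ (hRm a))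
  refine ⟨F, F.continuous, fun w hw => ?_⟩
  have := congrFun hF w
  simpa [f, hRe w hw] using this

/-- If a loop `γ` winds once around `0` and `g` is closer to `γ` along the boundary circle of a disk
than `γ` is to `0`, then `g` vanishes somewhere in the disk. -/
theorem WindsOnce.exists_eq_zero {γ : ℝ → ℂ} (hγ : WindsOnce γ)
    (hγc : ContinuousOn γ (Icc 0 (2 * Real.pi))) (hγp : γ (2 * Real.pi) = γ 0)
    {z : ℂ} {r : ℝ} (hr : 0 < r) {g : ℂ → ℂ} (hg : ContinuousOn g (Metric.closedBall z r))
    (hclose : ∀ t ∈ Icc 0 (2 * Real.pi), ‖g (circleMap z r t) - γ t‖ < ‖γ t‖) :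
    ∃ w ∈ Metric.closedBall z r, g w = 0 := by
  by_contra! h0
  obtain ⟨L, hLc, hL⟩ := exists_continuous_exp_eq hr hg h0
  obtain ⟨hγ0, θ, hθc, hθ, hθp⟩ := hγ
  have hmem (t : ℝ) : circleMap z r t ∈ Metric.closedBall z r :=
    circleMap_mem_closedBall z hr.le t
  -- The quotient stays within distance less than 1 of 1, so its principal logarithm is continuous
  -- along the circle.
  set u : ℝ → ℂ := fun t => g (circleMap z r t) / γ t with hu
  have huc : ContinuousOn u (Icc 0 (2 * Real.pi)) :=
    (hg.comp_continuous (continuous_circleMap z r) hmem).continuousOn.div hγc hγ0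
  have hus : ∀ t ∈ Icc 0 (2 * Real.pi), u t ∈ Complex.slitPlane := by
    intro t ht
    refine Complex.mem_slitPlane_of_norm_lt_one (z := u t - 1) ?_ |> fun h => by simpa using h
    have : u t - 1 = (g (circleMap z r t) - γ t) / γ t := by
      rw [sub_div, div_self (hγ0 t ht)]
    rw [this, norm_div, div_lt_one (norm_pos_iff.2 (hγ0 t ht))]
    exact hclose t ht
  have hlogc : ContinuousOn (fun t => Complex.log (u t)) (Icc 0 (2 * Real.pi)) :=
    huc.clog hus
  -- `L - log u` is a logarithm of `γ` with equal values at both ends, whereas `θ` gains 2π. Thus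
  -- `ψ` is continuous with values in 2πℤ, yet drops by 2π.
  set ψ : ℝ → ℝ := fun t => (L (circleMap z r t) - Complex.log (u t)).im - θ t with hψ
  have hψc : ContinuousOn ψ (Icc 0 (2 * Real.pi)) := by
    have h1 : ContinuousOn (fun t => L (circleMap z r t) - Complex.log (u t))
        (Icc 0 (2 * Real.pi)) :=
      (hLc.comp (continuous_circleMap z r)).continuousOn.sub hlogc
    exact (Complex.continuous_im.comp_continuousOn h1).sub hθc
  have hψe : ∀ t ∈ Icc 0 (2 * Real.pi), Complex.exp (ψ t * Complex.I) = 1 := by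
    intro t ht
    set w := L (circleMap z r t) - Complex.log (u t) with hw
    have hne := hγ0 t ht
    have hexp : Complex.exp w = γ t := by
      rw [hw, Complex.exp_sub, hL _ (hmem t), Complex.exp_log (Complex.slitPlane_ne_zero (hus t ht)),
        hu]
      have := h0 _ (hmem t)
      field_simp
    have hnorm : ‖γ t‖ = Real.exp w.re := by rw [← hexp, Complex.norm_exp]
    have h1 : Complex.exp (w.im * Complex.I) = Complex.exp (θ t * Complex.I) := by
      have h2 : Complex.exp w = Complex.exp w.re * Complex.exp (w.im * Complex.I) := by
        rw [← Complex.exp_add, Complex.re_add_im]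
      have h3 := hθ t ht
      rw [hnorm, Complex.ofReal_exp] at h3
      exact mul_left_cancel₀ (Complex.exp_ne_zero (w.re : ℂ)) (by rw [← h2, hexp, ← h3])
    have : ((ψ t : ℝ) : ℂ) * Complex.I = w.im * Complex.I - θ t * Complex.I := by
      simp only [hψ]; push_cast; ring
    rw [this, Complex.exp_sub, h1, div_self (Complex.exp_ne_zero _)]
  have hpi := Real.pi_pos
  have hcp : circleMap z r (2 * Real.pi) = circleMap z r 0 := by
    simpa using (periodic_circleMap z r) 0
  have hend : ψ (2 * Real.pi) = ψ 0 - 2 * Real.pi := by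
    simp only [hψ, hu, hcp, hγp, hθp]; ring
  -- Halfway down the drop, `exp (ψ t * I)` would be −1 instead of 1.
  obtain ⟨t, ht, htψ⟩ := intermediate_value_Icc' (by positivity : (0 : ℝ) ≤ 2 * Real.pi) hψc
    (show ψ 0 - Real.pi ∈ Icc (ψ (2 * Real.pi)) (ψ 0) by rw [hend]; constructor <;> linarith)
  have h1 := hψe t ht
  have h2 := hψe 0 ⟨le_rfl, by positivity⟩
  rw [htψ] at h1
  push_cast at h1
  rw [sub_mul, Complex.exp_sub, h2, Complex.exp_pi_mul_I] at h1
  norm_num at h1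

/-! ### Mollification of weak derivatives. -/

theorem MeasureTheory.IntegrableOn.integrable_indicator_of_isOpen {F : Type*}
    [NormedAddCommGroup F] {X : Set ℂ} (hX : IsOpen X) {g : ℂ → F} (hg : IntegrableOn g X) :
    Integrable (X.indicator g) :=
  hg.integrable_indicator hX.measurableSet

open scoped Convolution in
open ContinuousLinearMap in
/-- The weak derivative commutes with mollification away from the boundary. -/
theorem IsWeakDeriv.hasFDerivAt_convolution {X : Set ℂ} (hX : IsOpen X) {h : ℂ → ℂ}
    {G : ℂ → ℂ →L[ℝ] ℂ} (hG : IsWeakDeriv X h G) (hi : IntegrableOn h X) (hGi : IntegrableOn G X)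
    (φ : ContDiffBump (0 : ℂ)) {x : ℂ} (hx : Metric.closedBall x φ.rOut ⊆ X) :
    HasFDerivAt (φ.normed volume ⋆[lsmul ℝ ℝ, volume] X.indicator h)
      ((φ.normed volume ⋆[lsmul ℝ ℝ, volume] X.indicator G) x) x := by
  have hφ1 : ContDiff ℝ 1 (φ.normed volume) := φ.contDiff_normed (n := 1)
  have hφt : ContDiff ℝ ∞ (φ.normed volume) := φ.contDiff_normed (n := ⊤)
  have hli : LocallyIntegrable (X.indicator h) :=
    (hi.integrable_indicator_of_isOpen hX).locallyIntegrable
  have hlG : LocallyIntegrable (X.indicator G) :=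
    (hGi.integrable_indicator_of_isOpen hX).locallyIntegrable
  have key := φ.hasCompactSupport_normed (μ := volume) |>.hasFDerivAt_convolution_left
    (lsmul ℝ ℝ) hφ1 hli x
  suffices hD : (φ.normed volume ⋆[lsmul ℝ ℝ, volume] X.indicator G) x =
      (fderiv ℝ (φ.normed volume) ⋆[(lsmul ℝ ℝ).precompL ℂ, volume] X.indicator h) x by
    rw [hD]; exact key
  refine ContinuousLinearMap.ext fun v => ?_
  -- The reflected kernel serves as test function; the sign from the reflection cancels the one in
  -- the weak derivative.
  let ψ : ℂ → ℝ := fun t => φ.normed volume (x - t)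
  have hψd (t : ℂ) : fderiv ℝ ψ t v = - fderiv ℝ (φ.normed volume) (x - t) v := by
    have h1 : HasFDerivAt ψ ((fderiv ℝ (φ.normed volume) (x - t)).comp
        (-ContinuousLinearMap.id ℝ ℂ)) t :=
      ((hφ1.differentiable one_ne_zero) (x - t)).hasFDerivAt.comp t
        ((hasFDerivAt_id t).const_sub x)
    rw [h1.fderiv]; simp
  have hψs : tsupport ψ ⊆ Metric.closedBall x φ.rOut := by
    refine closure_minimal (fun t ht => ?_) Metric.isClosed_closedBall
    have : x - t ∈ Function.support (φ.normed volume) := ht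
    rw [φ.support_normed_eq] at this
    rw [Metric.mem_closedBall, dist_comm, dist_eq_norm]
    simpa using (mem_ball_zero_iff.1 this).le
  have hψc : HasCompactSupport ψ :=
    (isCompact_closedBall x φ.rOut).of_isClosed_subset (isClosed_tsupport _) hψs
  have hweak := hG.2.2 ψ (hφt.comp (contDiff_const.sub contDiff_id)) hψc (hψs.trans hx) v
  have e1 : (φ.normed volume ⋆[lsmul ℝ ℝ, volume] X.indicator G) x v =
      ∫ z in X, ψ z • G z v := by
    have hex := (φ.hasCompactSupport_normed (μ := volume)).convolutionExists_left
      (lsmul ℝ ℝ) hφ1.continuous hlG x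
    rw [convolution_eq_swap, ← integral_indicator hX.measurableSet,
      ContinuousLinearMap.integral_apply hex.integrable_swap]
    congr 1; ext t
    by_cases ht : t ∈ X <;> simp [ht, ψ]
  have e2 : (fderiv ℝ (φ.normed volume) ⋆[(lsmul ℝ ℝ).precompL ℂ, volume] X.indicator h) x v =
      - ∫ z in X, (fderiv ℝ ψ z v) • h z := by
    have hex := ((φ.hasCompactSupport_normed (μ := volume)).fderiv ℝ).convolutionExists_left
      ((lsmul ℝ ℝ : ℝ →L[ℝ] ℂ →L[ℝ] ℂ).precompL ℂ) (hφ1.continuous_fderiv one_ne_zero) hli x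
    rw [convolution_eq_swap, ← integral_indicator hX.measurableSet, ← integral_neg,
      ContinuousLinearMap.integral_apply hex.integrable_swap]
    congr 1; ext t
    by_cases ht : t ∈ X <;> simp [ht, hψd]
  rw [e1, e2, hweak, neg_neg]

/-- The Cauchy-Schwarz inequality for a probability measure. -/
theorem sq_lintegral_le_lintegral_sq {α : Type*} [MeasurableSpace α] (ν : Measure α)
    [IsProbabilityMeasure ν] {u : α → ℝ≥0∞} (hu : AEMeasurable u ν) :
    (∫⁻ a, u a ∂ν) ^ 2 ≤ ∫⁻ a, u a ^ 2 ∂ν := by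
  have := ENNReal.lintegral_mul_le_Lp_mul_Lq ν Real.HolderConjugate.two_two
    (aemeasurable_const (b := (1 : ℝ≥0∞))) hu
  simp only [Pi.mul_apply, one_mul, lintegral_const, measure_univ, mul_one, ENNReal.rpow_ofNat,
    one_pow, ENNReal.one_rpow] at this
  calc (∫⁻ a, u a ∂ν) ^ 2 ≤ ((∫⁻ a, u a ^ 2 ∂ν) ^ (1 / 2 : ℝ)) ^ 2 := by gcongr
    _ = _ := by rw [← ENNReal.rpow_natCast, ← ENNReal.rpow_mul]; norm_num

open scoped Convolution in
open ContinuousLinearMap in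
/-- Mollification does not increase the `L²` norm. -/
theorem lintegral_enorm_sq_convolution_le {F : Type*} [NormedAddCommGroup F] [NormedSpace ℝ F]
    (φ : ContDiffBump (0 : ℂ)) {g : ℂ → F} (hg : AEStronglyMeasurable g) :
    ∫⁻ x, ‖(φ.normed volume ⋆[lsmul ℝ ℝ, volume] g) x‖ₑ ^ 2 ≤ ∫⁻ x, ‖g x‖ₑ ^ 2 := by
  have hφc : Continuous (φ.normed (volume : Measure ℂ)) := (φ.contDiff_normed (n := 0)).continuous
  have hφm : Measurable fun t => ‖φ.normed (volume : Measure ℂ) t‖ₑ := by fun_prop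
  have hφ1 : ∫⁻ t, ‖φ.normed (volume : Measure ℂ) t‖ₑ = 1 := by
    have : ∫⁻ t, ENNReal.ofReal (φ.normed (volume : Measure ℂ) t) = 1 := by
      rw [← ofReal_integral_eq_lintegral_ofReal φ.integrable_normed
        (Filter.Eventually.of_forall φ.nonneg_normed), φ.integral_normed, ENNReal.ofReal_one]
    rw [← this]
    congr 1; ext t
    exact Real.enorm_eq_ofReal (φ.nonneg_normed t)
  -- The kernel is a probability density, so Cauchy-Schwarz bounds the squared average by the
  -- average of squares; Tonelli and translation invariance finish.
  let ν : Measure ℂ := volume.withDensity fun t => ‖φ.normed (volume : Measure ℂ) t‖ₑ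
  have : IsProbabilityMeasure ν := ⟨by simp [ν, hφ1]⟩
  have hpt (x : ℂ) : ‖(φ.normed volume ⋆[lsmul ℝ ℝ, volume] g) x‖ₑ ^ 2 ≤
      ∫⁻ t, ‖φ.normed (volume : Measure ℂ) t‖ₑ * ‖g (x - t)‖ₑ ^ 2 := by
    have hgx : AEMeasurable (fun t => ‖g (x - t)‖ₑ) :=
      (hg.comp_quasiMeasurePreserving
        (Measure.measurePreserving_sub_left volume x).quasiMeasurePreserving).enorm
    have hgν : AEMeasurable (fun t => ‖g (x - t)‖ₑ) ν :=
      hgx.mono_ac (withDensity_absolutelyContinuous _ _)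
    have h1 : ‖(φ.normed volume ⋆[lsmul ℝ ℝ, volume] g) x‖ₑ ≤ ∫⁻ t, ‖g (x - t)‖ₑ ∂ν := by
      rw [lintegral_withDensity_eq_lintegral_mul₀ hφm.aemeasurable hgx, convolution_def]
      refine (enorm_integral_le_lintegral_enorm _).trans_eq ?_
      simp [enorm_smul]
    calc _ ≤ (∫⁻ t, ‖g (x - t)‖ₑ ∂ν) ^ 2 := by gcongr
      _ ≤ ∫⁻ t, ‖g (x - t)‖ₑ ^ 2 ∂ν := sq_lintegral_le_lintegral_sq ν hgν
      _ = _ := by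
        rw [lintegral_withDensity_eq_lintegral_mul₀ hφm.aemeasurable (hgx.pow_const 2)]
        rfl
  calc _ ≤ ∫⁻ x, ∫⁻ t, ‖φ.normed (volume : Measure ℂ) t‖ₑ * ‖g (x - t)‖ₑ ^ 2 := lintegral_mono hpt
    _ = ∫⁻ t, ∫⁻ x, ‖φ.normed (volume : Measure ℂ) t‖ₑ * ‖g (x - t)‖ₑ ^ 2 := by
      refine lintegral_lintegral_swap ?_
      refine (hφm.comp measurable_snd).aemeasurable.mul (AEMeasurable.pow_const ?_ 2)
      exact (hg.comp_quasiMeasurePreserving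
        (quasiMeasurePreserving_sub_of_right_invariant volume volume)).enorm
    _ = ∫⁻ t, ‖φ.normed (volume : Measure ℂ) t‖ₑ * ∫⁻ x, ‖g x‖ₑ ^ 2 := by
      congr 1; ext t
      rw [lintegral_const_mul' _ _ enorm_ne_top,
        lintegral_sub_right_eq_self (fun x => ‖g x‖ₑ ^ 2) t]
    _ = _ := by rw [lintegral_mul_const _ hφm, hφ1, one_mul]

/-! ### Determinant bounds for real-linear maps of the plane. -/

theorem ContinuousLinearMap.det_complex (L : ℂ →L[ℝ] ℂ) :
    L.det = (L 1).re * (L Complex.I).im - (L Complex.I).re * (L 1).im := by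
  rw [ContinuousLinearMap.det, ← LinearMap.det_toMatrix Complex.basisOneI, Matrix.det_fin_two]
  simp [LinearMap.toMatrix_apply]

/-- Lagrange's identity: ‖L 1‖²‖L i‖² − (det L)² is the square of the inner product of the two
columns. -/
theorem ContinuousLinearMap.abs_det_complex_le (L : ℂ →L[ℝ] ℂ) :
    |L.det| ≤ ‖L 1‖ * ‖L Complex.I‖ := by
  refine abs_le_of_sq_le_sq ?_ (by positivity)
  rw [mul_pow, Complex.sq_norm, Complex.sq_norm, Complex.normSq_apply, Complex.normSq_apply,
    L.det_complex]
  nlinarith [sq_nonneg ((L 1).re * (L Complex.I).re + (L 1).im * (L Complex.I).im)]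

theorem ContinuousLinearMap.ofReal_abs_det_complex_le (L : ℂ →L[ℝ] ℂ) :
    ENNReal.ofReal |L.det| ≤ ‖L‖ₑ ^ 2 := by
  rw [← ofReal_norm, ← ENNReal.ofReal_pow (norm_nonneg _)]
  refine ENNReal.ofReal_le_ofReal (L.abs_det_complex_le.trans ?_)
  have h1 : ‖L 1‖ ≤ ‖L‖ := by simpa using L.le_opNorm 1
  have h2 : ‖L Complex.I‖ ≤ ‖L‖ := by simpa using L.le_opNorm Complex.I
  rw [sq]
  gcongr

/-! ### The area inequality. -/

/-- The points of `X` whose distance to the complement of `X` exceeds `ρ`. -/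
def innerPart (X : Set ℂ) (ρ : ℝ) : Set ℂ := {x | ENNReal.ofReal ρ < Metric.infEDist x Xᶜ}

theorem isOpen_innerPart (X : Set ℂ) (ρ : ℝ) : IsOpen (innerPart X ρ) :=
  isOpen_lt continuous_const Metric.continuous_infEDist

theorem closedBall_subset_of_mem_innerPart {X : Set ℂ} {ρ : ℝ} {x : ℂ} (hx : x ∈ innerPart X ρ) :
    Metric.closedBall x ρ ⊆ X := by
  intro y hy
  by_contra hyX
  refine absurd (lt_of_lt_of_le hx (Metric.infEDist_le_edist_of_mem hyX)) (not_lt.2 ?_)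
  rw [edist_dist, dist_comm]
  exact ENNReal.ofReal_le_ofReal hy

theorem mem_innerPart {X : Set ℂ} {ρ δ : ℝ} {x : ℂ} (hδ : 0 < δ) (hρ : ρ < δ)
    (hx : Metric.closedBall x δ ⊆ X) : x ∈ innerPart X ρ := by
  refine lt_of_lt_of_le ((ENNReal.ofReal_lt_ofReal_iff hδ).2 hρ) (Metric.le_infEDist.2 ?_)
  intro y hy
  rw [edist_dist]
  refine ENNReal.ofReal_le_ofReal (le_of_not_ge fun h => hy (hx ?_))
  rwa [Metric.mem_closedBall, dist_comm]

/-- A sequence of bump functions at the origin whose supports shrink to a point. -/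
noncomputable def shrinkingBump (n : ℕ) : ContDiffBump (0 : ℂ) where
  rIn := 1 / (n + 1)
  rOut := 2 * (1 / (n + 1))
  rIn_pos := by positivity
  rIn_lt_rOut := by
    have : (0 : ℝ) < 1 / (n + 1) := by positivity
    linarith

theorem tendsto_shrinkingBump_rOut :
    Filter.Tendsto (fun n => (shrinkingBump n).rOut) Filter.atTop (nhds 0) := by
  simpa [shrinkingBump] using (tendsto_one_div_add_atTop_nhds_zero_nat (𝕜 := ℝ)).const_mul 2

open scoped Convolution in
open ContinuousLinearMap in
/-- Every value of an orientation-preserving continuous Sobolev map is eventually attained by its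
mollifications. -/
theorem PreservesOrientation.eventually_mem_image_convolution {X : Set ℂ} (hX : IsOpen X)
    {h : ℂ → ℂ} (hc : ContinuousOn h X) (ho : PreservesOrientation X h) {G : ℂ → ℂ →L[ℝ] ℂ}
    (hG : IsWeakDeriv X h G) (hi : IntegrableOn h X) (hGi : IntegrableOn G X) {x : ℂ}
    (hx : x ∈ X) :
    ∀ᶠ n in Filter.atTop, h x ∈
      ((shrinkingBump n).normed volume ⋆[lsmul ℝ ℝ, volume] X.indicator h) ''
        innerPart X (shrinkingBump n).rOut := by
  obtain ⟨ε, hε, hεX⟩ := Metric.nhds_basis_closedBall.mem_iff.1 (hX.mem_nhds hx)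
  -- The spare radius δ keeps the mollification at points of the δ-ball dependent only on values of
  -- `h` in the 2δ-ball inside `X`.
  obtain ⟨δ, rfl⟩ : ∃ δ, ε = δ + δ := ⟨ε / 2, by ring⟩
  have hδ : 0 < δ := by linarith
  have hsub {w : ℂ} (hw : w ∈ Metric.closedBall x δ) {ρ : ℝ} (hρ : ρ ≤ δ) :
      Metric.closedBall w ρ ⊆ Metric.closedBall x (δ + δ) :=
    Metric.closedBall_subset_closedBall' (by rw [Metric.mem_closedBall] at hw; linarith)
  have hδX : Metric.closedBall x δ ⊆ X :=
    (Metric.closedBall_subset_closedBall (by linarith)).trans hεX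
  have hw := ho x δ hδ hδX
  have hmem (t : ℝ) : circleMap x δ t ∈ Metric.closedBall x δ :=
    circleMap_mem_closedBall x hδ.le t
  have hγc : Continuous fun t => h (circleMap x δ t) - h x :=
    (hc.comp_continuous (continuous_circleMap x δ) fun t => hδX (hmem t)).sub continuous_const
  -- The image circle keeps distance `m` from `h x`; mollifying moves it by at most `m / 2`, so the
  -- winding lemma applies.
  obtain ⟨m, hm, hmγ⟩ : ∃ m > 0, ∀ t ∈ Icc 0 (2 * Real.pi),
      m ≤ ‖h (circleMap x δ t) - h x‖ := by
    obtain ⟨s, hs, hsm⟩ := (isCompact_Icc (a := (0 : ℝ)) (b := 2 * Real.pi)).exists_isMinOn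
      ⟨0, le_rfl, by positivity⟩ hγc.norm.continuousOn
    exact ⟨_, norm_pos_iff.2 (hw.1 s hs), fun t ht => hsm ht⟩
  have huc := (isCompact_closedBall x (δ + δ)).uniformContinuousOn_of_continuous (hc.mono hεX)
  obtain ⟨ρ, hρ, hρh⟩ := Metric.uniformContinuousOn_iff.1 huc (m / 2) (by positivity)
  filter_upwards [tendsto_shrinkingBump_rOut.eventually_lt_const (lt_min hρ hδ)] with n hn
  set φ := shrinkingBump n
  have hnρ : φ.rOut < ρ := hn.trans_le (min_le_left _ _)
  have hnδ : φ.rOut < δ := hn.trans_le (min_le_right _ _)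
  set H := φ.normed volume ⋆[lsmul ℝ ℝ, volume] X.indicator h with hH
  have hHc : ContinuousOn (fun w => H w - h x) (Metric.closedBall x δ) := by
    intro w hwδ
    exact ((hG.hasFDerivAt_convolution hX hi hGi φ
      ((hsub hwδ hnδ.le).trans hεX)).continuousAt.sub continuousAt_const).continuousWithinAt
  obtain ⟨w, hwδ, hw0⟩ := hw.exists_eq_zero hγc.continuousOn
    (by simpa using congrArg (fun w => h w - h x) (periodic_circleMap x δ 0)) hδ hHc
    (fun t ht => by
      refine lt_of_le_of_lt (b := m / 2) ?_ (by linarith [hmγ t ht])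
      set w := circleMap x δ t
      have hwX : w ∈ X := hδX (hmem t)
      have hd : dist (H w) (X.indicator h w) ≤ m / 2 := by
        refine φ.dist_normed_convolution_le
          (hi.integrable_indicator_of_isOpen hX).aestronglyMeasurable ?_
        intro y hy
        have hyK := hsub (hmem t) hnδ.le (Metric.ball_subset_closedBall hy)
        rw [indicator_of_mem (hεX hyK), indicator_of_mem hwX]
        exact (hρh y hyK w (hsub (hmem t) le_rfl (Metric.mem_closedBall_self hδ.le))
          ((Metric.mem_ball.1 hy).trans hnρ)).le
      rw [indicator_of_mem hwX, dist_eq_norm] at hd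
      simpa using hd)
  exact ⟨w, mem_innerPart hδ hnδ ((hsub hwδ le_rfl).trans hεX), sub_eq_zero.1 hw0⟩

theorem lintegral_enorm_sq_indicator {F : Type*} [NormedAddCommGroup F] {X : Set ℂ}
    (hX : MeasurableSet X) (g : ℂ → F) :
    ∫⁻ x, ‖X.indicator g x‖ₑ ^ 2 = ∫⁻ x in X, ‖g x‖ₑ ^ 2 := by
  rw [← lintegral_indicator hX]
  refine lintegral_congr fun x => ?_
  by_cases hx : x ∈ X <;> simp [hx]

open scoped Convolution in
open ContinuousLinearMap in
/-- The area inequality for orientation-preserving continuous maps with square-integrable weak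
derivative. -/
theorem PreservesOrientation.volume_image_le {X : Set ℂ} (hX : IsOpen X)
    {h : ℂ → ℂ} (hc : ContinuousOn h X) (ho : PreservesOrientation X h) {G : ℂ → ℂ →L[ℝ] ℂ}
    (hG : IsWeakDeriv X h G) (hi : IntegrableOn h X) (hGi : IntegrableOn G X)
    (hG2 : ∫⁻ x in X, ‖G x‖ₑ ^ 2 ≠ ⊤) :
    volume (h '' X) ≤ ∫⁻ x in X, ENNReal.ofReal |(G x).det| := by
  have hGint : Integrable (X.indicator G) := hGi.integrable_indicator_of_isOpen hX
  set H : ℕ → ℂ → ℂ := fun n =>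
    (shrinkingBump n).normed volume ⋆[lsmul ℝ ℝ, volume] X.indicator h
  set D : ℕ → ℂ → ℂ →L[ℝ] ℂ := fun n =>
    (shrinkingBump n).normed volume ⋆[lsmul ℝ ℝ, volume] X.indicator G
  set U : ℕ → Set ℂ := fun n => innerPart X (shrinkingBump n).rOut
  have hUX (n : ℕ) : U n ⊆ X := fun x hx => closedBall_subset_of_mem_innerPart hx
    (Metric.mem_closedBall_self (shrinkingBump n).rOut_pos.le)
  have hDc (n : ℕ) : Continuous (D n) :=
    (shrinkingBump n).hasCompactSupport_normed.continuous_convolution_left _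
      ((shrinkingBump n).contDiff_normed (n := 0)).continuous hGint.locallyIntegrable
  set J : ℕ → ℂ → ℝ≥0∞ := fun n => (U n).indicator fun x => ENNReal.ofReal |(D n x).det|
  -- Fatou gives only lower bounds on limits, but an upper bound on the Jacobian integrals is
  -- wanted; hence it is applied to this nonnegative complement.
  set b : ℕ → ℂ → ℝ≥0∞ := fun n x => ‖D n x‖ₑ ^ 2 - J n x
  have hJm (n : ℕ) : Measurable (J n) :=
    (ENNReal.measurable_ofReal.comp
      (ContinuousLinearMap.continuous_det.comp (hDc n)).abs.measurable).indicator
      (isOpen_innerPart _ _).measurableSet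
  have hJle (n : ℕ) (x : ℂ) : J n x ≤ ‖D n x‖ₑ ^ 2 :=
    (indicator_le_self _ _ x).trans (D n x).ofReal_abs_det_complex_le
  have hDm (n : ℕ) : Measurable fun x => ‖D n x‖ₑ ^ 2 := (hDc n).enorm.measurable.pow_const 2
  have hbm (n : ℕ) : Measurable (b n) := (hDm n).sub (hJm n)
  -- Values attained by every mollification from index `N` on; these sets increase and cover `h ''
  -- X`.
  set A : ℕ → Set ℂ := fun N => ⋂ n ≥ N, H n '' U n
  have hA : h '' X ⊆ ⋃ N, A N := by
    rintro _ ⟨x, hx, rfl⟩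
    obtain ⟨N, hN⟩ := Filter.eventually_atTop.1
      (ho.eventually_mem_image_convolution hX hc hG hi hGi hx)
    exact mem_iUnion.2 ⟨N, mem_iInter₂.2 hN⟩
  have hAmono : Monotone A := fun M N hMN =>
    biInter_subset_biInter_left fun n (hn : N ≤ n) => hMN.trans hn
  have hAJ {N n : ℕ} (hn : N ≤ n) : volume (A N) ≤ ∫⁻ x in X, J n x := by
    calc volume (A N) ≤ volume (H n '' U n) := measure_mono (biInter_subset_of_mem hn)
      _ ≤ ∫⁻ x in U n, ENNReal.ofReal |(D n x).det| :=
        addHaar_image_le_lintegral_abs_det_fderiv volume (isOpen_innerPart _ _).measurableSet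
          fun x hx => (hG.hasFDerivAt_convolution hX hi hGi (shrinkingBump n)
            (closedBall_subset_of_mem_innerPart hx)).hasFDerivWithinAt
      _ = ∫⁻ x in X, J n x := by
        rw [setLIntegral_indicator (isOpen_innerPart _ _).measurableSet,
          inter_eq_left.2 (hUX n)]
  have hsum (n : ℕ) : (∫⁻ x in X, J n x) + ∫⁻ x in X, b n x ≤ ∫⁻ x in X, ‖G x‖ₑ ^ 2 := by
    calc (∫⁻ x in X, J n x) + ∫⁻ x in X, b n x = ∫⁻ x in X, ‖D n x‖ₑ ^ 2 := by
          rw [← lintegral_add_left (hJm n)]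
          exact lintegral_congr fun x => add_tsub_cancel_of_le (hJle n x)
      _ ≤ ∫⁻ x, ‖D n x‖ₑ ^ 2 := setLIntegral_le_lintegral _ _
      _ ≤ ∫⁻ x, ‖X.indicator G x‖ₑ ^ 2 :=
        lintegral_enorm_sq_convolution_le _ hGint.aestronglyMeasurable
      _ = ∫⁻ x in X, ‖G x‖ₑ ^ 2 := lintegral_enorm_sq_indicator hX.measurableSet G
  set B := ∫⁻ x in X, (‖G x‖ₑ ^ 2 - ENNReal.ofReal |(G x).det|)
  have hB : B ≤ Filter.liminf (fun n => ∫⁻ x in X, b n x) Filter.atTop := by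
    refine le_trans (lintegral_mono_ae ?_) (lintegral_liminf_le hbm)
    -- `K = 2` is the fixed ratio of outer to inner radius in `shrinkingBump`, which makes Lebesgue
    -- differentiation applicable.
    have hlim := ContDiffBump.ae_convolution_tendsto_right_of_locallyIntegrable
      tendsto_shrinkingBump_rOut (K := 2) (Filter.Eventually.of_forall fun n => le_rfl)
      hGint.locallyIntegrable
    filter_upwards [ae_restrict_of_ae hlim, ae_restrict_mem hX.measurableSet] with x hx hxX
    rw [indicator_of_mem hxX] at hx
    refine (Filter.Tendsto.liminf_eq ?_).ge
    refine ENNReal.Tendsto.sub ((ENNReal.continuous_pow 2).tendsto _ |>.comp hx.enorm) ?_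
      (Or.inr ENNReal.ofReal_ne_top)
    have h1 : Filter.Tendsto (fun n => ENNReal.ofReal |(D n x).det|) Filter.atTop
        (nhds (ENNReal.ofReal |(G x).det|)) :=
      ENNReal.tendsto_ofReal ((ContinuousLinearMap.continuous_det.tendsto _).comp hx).abs
    refine h1.congr' ?_
    obtain ⟨ε, hε, hεX⟩ := Metric.nhds_basis_closedBall.mem_iff.1 (hX.mem_nhds hxX)
    filter_upwards [tendsto_shrinkingBump_rOut.eventually_lt_const hε] with n hn
    exact (indicator_of_mem (s := U n) (mem_innerPart hε hn hεX)
      fun x => ENNReal.ofReal |(D n x).det|).symm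
  have hBle : B ≤ ∫⁻ x in X, ‖G x‖ₑ ^ 2 := lintegral_mono fun x => tsub_le_self
  have hAB (N : ℕ) : volume (A N) + B ≤ ∫⁻ x in X, ‖G x‖ₑ ^ 2 := by
    have hAle : volume (A N) ≤ ∫⁻ x in X, ‖G x‖ₑ ^ 2 :=
      (hAJ le_rfl).trans (le_self_add.trans (hsum N))
    have hle : B ≤ (∫⁻ x in X, ‖G x‖ₑ ^ 2) - volume (A N) := by
      refine hB.trans ?_
      refine Filter.liminf_le_of_frequently_le' (Filter.Eventually.frequently ?_)
      filter_upwards [Filter.eventually_ge_atTop N] with n hn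
      refine ENNReal.le_sub_of_add_le_left (ne_top_of_le_ne_top hG2 hAle) ?_
      exact (add_le_add_left (hAJ hn) _).trans (hsum n)
    calc volume (A N) + B ≤ volume (A N) + ((∫⁻ x in X, ‖G x‖ₑ ^ 2) - volume (A N)) := by gcongr
      _ = _ := add_tsub_cancel_of_le hAle
  have hGdet : ∫⁻ x in X, ‖G x‖ₑ ^ 2 = (∫⁻ x in X, ENNReal.ofReal |(G x).det|) + B := by
    rw [← lintegral_add_left']
    · exact lintegral_congr fun x => (add_tsub_cancel_of_le (G x).ofReal_abs_det_complex_le).symm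
    · exact ENNReal.measurable_ofReal.comp_aemeasurable
        (continuous_abs.comp_aestronglyMeasurable
          (ContinuousLinearMap.continuous_det.comp_aestronglyMeasurable
            hGi.aestronglyMeasurable)).aemeasurable
  -- Now |A_N| + B ≤ ∫|det G| + B with B finite, so B cancels, and N → ∞ by continuity from below.
  refine (measure_mono hA).trans ?_
  rw [hAmono.measure_iUnion]
  refine iSup_le fun N => ?_
  have := hAB N
  rw [hGdet] at this
  exact (ENNReal.add_le_add_iff_right (ne_top_of_le_ne_top hG2 hBle)).1 this

/-! ### Uniqueness of weak derivatives, and the identity map. -/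

theorem MeasureTheory.LocallyIntegrableOn.integrable_smul_of_tsupport_subset {F : Type*}
    [NormedAddCommGroup F] [NormedSpace ℝ F] {X : Set ℂ} {g : ℂ → F} (hg : LocallyIntegrableOn g X)
    {φ : ℂ → ℝ} (hφ : Continuous φ) (hφc : HasCompactSupport φ) (hφX : tsupport φ ⊆ X) :
    Integrable fun z => φ z • g z := by
  have hK : IntegrableOn g (tsupport φ) := hg.integrableOn_compact_subset hφX hφc
  exact (integrableOn_iff_integrable_of_support_subset (s := tsupport φ)
    ((Function.support_smul_subset_left φ g).trans (subset_tsupport φ))).1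
    (hK.continuousOn_smul hφ.continuousOn hφc)

/-- Weak derivatives are unique up to a null set. -/
theorem IsWeakDeriv.ae_eq {X : Set ℂ} (hX : IsOpen X) {h : ℂ → ℂ} {G₁ G₂ : ℂ → ℂ →L[ℝ] ℂ}
    (h₁ : IsWeakDeriv X h G₁) (h₂ : IsWeakDeriv X h G₂) : G₁ =ᵐ[volume.restrict X] G₂ := by
  have hsub : LocallyIntegrableOn (fun z => G₁ z - G₂ z) X := h₁.2.1.sub h₂.2.1
  have key := hX.ae_eq_zero_of_integral_contDiff_smul_eq_zero hsub fun φ hφ hφc hφX => by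
    have hint {G : ℂ → ℂ →L[ℝ] ℂ} (hG : LocallyIntegrableOn G X) :
        Integrable fun z => φ z • G z :=
      hG.integrable_smul_of_tsupport_subset hφ.continuous hφc hφX
    have heq {G : ℂ → ℂ →L[ℝ] ℂ} (hG : LocallyIntegrableOn G X) (v : ℂ) :
        (∫ z, φ z • G z) v = ∫ z in X, φ z • G z v := by
      rw [ContinuousLinearMap.integral_apply (hint hG), ← integral_indicator hX.measurableSet]
      refine integral_congr_ae (Filter.Eventually.of_forall fun z => ?_)
      by_cases hz : z ∈ X
      · simp [hz]
      · simp [hz, image_eq_zero_of_notMem_tsupport fun hz' => hz (hφX hz')]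
    simp only [smul_sub]
    rw [integral_sub (hint h₁.2.1) (hint h₂.2.1), sub_eq_zero]
    refine ContinuousLinearMap.ext fun v => ?_
    rw [heq h₁.2.1, heq h₂.2.1]
    exact neg_injective ((h₁.2.2 φ hφ hφc hφX v).symm.trans (h₂.2.2 φ hφ hφc hφX v))
  rw [Filter.EventuallyEq, ae_restrict_iff' hX.measurableSet]
  filter_upwards [key] with z hz hzX
  exact sub_eq_zero.1 (hz hzX)

theorem IsWeakDeriv.weakDeriv {X : Set ℂ} {h : ℂ → ℂ} {G : ℂ → ℂ →L[ℝ] ℂ}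
    (hG : IsWeakDeriv X h G) : IsWeakDeriv X h (weakDeriv X h) := by
  have H : ∃ G : ℂ → ℂ →L[ℝ] ℂ, IsWeakDeriv X h G := ⟨G, hG⟩
  rw [_root_.weakDeriv, dif_pos H]
  exact H.choose_spec

theorem isWeakDeriv_id (X : Set ℂ) :
    IsWeakDeriv X id fun _ => ContinuousLinearMap.id ℝ ℂ := by
  refine ⟨continuous_id.locallyIntegrable.locallyIntegrableOn X,
    continuous_const.locallyIntegrable.locallyIntegrableOn X, fun φ hφ hφc hφX v => ?_⟩
  have hφ1 : Continuous fun z => fderiv ℝ φ z v :=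
    (hφ.continuous_fderiv (by simp)).clm_apply continuous_const
  have hφ1c : HasCompactSupport fun z => fderiv ℝ φ z v := hφc.fderiv_apply ℝ v
  have hsupp {z : ℂ} (hz : z ∉ X) : z ∉ tsupport φ := fun h => hz (hφX h)
  have e1 : ∫ z in X, (fderiv ℝ φ z v) • id z = ∫ z, (fderiv ℝ φ z v) • id z := by
    refine setIntegral_eq_integral_of_forall_compl_eq_zero fun z hz => ?_
    have : fderiv ℝ φ z = 0 :=
      image_eq_zero_of_notMem_tsupport fun h => hsupp hz (tsupport_fderiv_subset ℝ h)
    simp [this]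
  have e2 : ∫ z in X, φ z • ContinuousLinearMap.id ℝ ℂ v = ∫ z, φ z • v := by
    refine setIntegral_eq_integral_of_forall_compl_eq_zero fun z hz => ?_
    simp [image_eq_zero_of_notMem_tsupport (hsupp hz)]
  have key := integral_smul_fderiv_eq_neg_fderiv_smul_of_integrable (μ := volume)
    (f := φ) (g := (id : ℂ → ℂ)) (v := v) (𝕜 := ℝ)
    ((hφ1.smul continuous_id).integrable_of_hasCompactSupport hφ1c.smul_right)
    (by
      simp only [fderiv_id]
      exact (hφ.continuous.smul continuous_const).integrable_of_hasCompactSupport hφc.smul_right)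
    ((hφ.continuous.smul continuous_id).integrable_of_hasCompactSupport hφc.smul_right)
    (fun x _ => hφ.differentiable (by simp) x) (fun x _ => differentiableAt_id)
  simp only [fderiv_id, ContinuousLinearMap.id_apply] at key
  rw [e1, e2, key, neg_neg]

theorem preservesOrientation_id (X : Set ℂ) : PreservesOrientation X id := by
  intro z r hr _
  refine ⟨fun t _ => ?_, fun t => t, continuousOn_id, fun t _ => ?_, by ring⟩
  · simp [circleMap, hr.ne', Complex.exp_ne_zero]
  · simp [circleMap, Complex.norm_exp, abs_of_pos hr]

theorem isHomeoOnto_id (X : Set ℂ) : IsHomeoOnto X X id := ⟨Homeomorph.refl X, fun _ => rfl⟩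

theorem IsBoundedDomain.volume_ne_top {X : Set ℂ} (hX : IsBoundedDomain X) : volume X ≠ ⊤ :=
  hX.isBounded.measure_lt_top.ne

theorem IsBoundedDomain.memSobolev_id {X : Set ℂ} (hX : IsBoundedDomain X) (p : ℝ) :
    MemSobolev p X id := by
  have : IsFiniteMeasure (volume.restrict X) := ⟨by simpa using hX.volume_ne_top.lt_top⟩
  refine ⟨?_, _, isWeakDeriv_id X, memLp_const _⟩
  obtain ⟨R, hR⟩ := hX.isBounded.exists_norm_le
  refine MemLp.of_bound continuous_id.aestronglyMeasurable R ?_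
  filter_upwards [ae_restrict_mem hX.isOpen.measurableSet] with z hz using hR z hz

theorem hsNorm_id_rpow (p : ℝ) : hsNorm (ContinuousLinearMap.id ℝ ℂ) ^ p = 2 ^ (p / 2) := by
  simp only [hsNorm, ContinuousLinearMap.id_apply, norm_one, Complex.norm_I]
  rw [Real.sqrt_eq_rpow, ← Real.rpow_mul (by norm_num)]
  norm_num
  ring_nf

theorem neohookeanEnergy_id {X : Set ℂ} (hX : IsOpen X) (p : ℝ) :
    neohookeanEnergy p 1 X id = ENNReal.ofReal (2 ^ (p / 2) + 1) * volume X := by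
  have hae := (isWeakDeriv_id X).weakDeriv.ae_eq hX (isWeakDeriv_id X)
  rw [neohookeanEnergy, ← setLIntegral_const]
  refine lintegral_congr_ae ?_
  filter_upwards [hae] with z hz
  rw [hz, hsNorm_id_rpow, ContinuousLinearMap.det_complex,
    ENNReal.ofReal_add (by positivity) zero_le_one]
  simp

/-! ### The pointwise tangent-line bound. -/

/-- `|L|² ≥ 2 |det L|` for the Hilbert-Schmidt norm. -/
theorem two_mul_abs_det_le_sq_hsNorm (L : ℂ →L[ℝ] ℂ) : 2 * |L.det| ≤ hsNorm L ^ 2 := by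
  rw [hsNorm, Real.sq_sqrt (by positivity)]
  nlinarith [L.abs_det_complex_le, sq_nonneg (‖L 1‖ - ‖L Complex.I‖)]

/-- The slope at `1` of `t ↦ 2 ^ (p / 2) * t ^ (p / 2) + 1 / t`. -/
noncomputable def neohookeanSlope (p : ℝ) : ℝ := 2 ^ (p / 2) * (p / 2) - 1

/-- Nonnegativity of the slope is what turns a lower bound on ∫|det Dh| into a lower bound on the
energy. -/
theorem neohookeanSlope_pos {p : ℝ} (hp : 2 ≤ p) : 0 < neohookeanSlope p := by
  have h1 : (2 : ℝ) ≤ 2 ^ (p / 2) := by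
    simpa using Real.rpow_le_rpow_of_exponent_le one_le_two (show (1 : ℝ) ≤ p / 2 by linarith)
  have : (2 : ℝ) * 1 ≤ 2 ^ (p / 2) * (p / 2) := by
    gcongr
    linarith
  unfold neohookeanSlope
  linarith

/-- The stored-energy density lies above its tangent line in `|det L|` at `|det L| = 1`. -/
theorem tangent_le_energy_density {p : ℝ} (hp : 2 ≤ p) (L : ℂ →L[ℝ] ℂ) :
    ENNReal.ofReal (2 ^ (p / 2) + 1) + ENNReal.ofReal (neohookeanSlope p) *
      ENNReal.ofReal |L.det| ≤
    ENNReal.ofReal (neohookeanSlope p) + (ENNReal.ofReal (hsNorm L ^ p) +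
      (ENNReal.ofReal L.det ^ (1 : ℝ))⁻¹) := by
  have ha := neohookeanSlope_pos hp
  -- For det L ≤ 0 the right side is infinite, as the inverse of 0 in `ℝ≥0∞` is ⊤.
  rcases le_or_gt L.det 0 with hJ | hJ
  · simp [ENNReal.ofReal_of_nonpos hJ]
  have hhs : 0 ≤ hsNorm L := Real.sqrt_nonneg _
  rw [ENNReal.rpow_one, ← ENNReal.ofReal_inv_of_pos hJ, ← ENNReal.ofReal_mul ha.le,
    ← ENNReal.ofReal_add (by positivity) (by positivity),
    ← ENNReal.ofReal_add (by positivity) (by positivity),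
    ← ENNReal.ofReal_add ha.le (by positivity)]
  refine ENNReal.ofReal_le_ofReal ?_
  have h1 : (2 * L.det) ^ (p / 2) ≤ hsNorm L ^ p := by
    have := Real.rpow_le_rpow (by positivity)
      (abs_of_pos hJ ▸ two_mul_abs_det_le_sq_hsNorm L) (show 0 ≤ p / 2 by linarith)
    rwa [← Real.rpow_natCast, ← Real.rpow_mul hhs, Nat.cast_ofNat,
      mul_div_cancel₀ p two_ne_zero] at this
  rw [Real.mul_rpow zero_le_two hJ.le] at h1
  -- Tangent lines at 1 of the two convex terms: Bernoulli's inequality here, 1/J ≥ 2 − J next.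
  -- Weighted by 2^(p/2) and 1, their slopes add up to `neohookeanSlope p`.
  have h2 : 1 + p / 2 * (L.det - 1) ≤ L.det ^ (p / 2) := by
    simpa using one_add_mul_self_le_rpow_one_add (s := L.det - 1) (by linarith)
      (show 1 ≤ p / 2 by linarith)
  have h3 : 2 - L.det ≤ L.det⁻¹ := by
    rw [← mul_le_mul_iff_of_pos_right hJ, inv_mul_cancel₀ hJ.ne']
    nlinarith [sq_nonneg (L.det - 1)]
  have h4 : (2 : ℝ) ^ (p / 2) * (1 + p / 2 * (L.det - 1)) ≤ 2 ^ (p / 2) * L.det ^ (p / 2) := by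
    gcongr
  rw [abs_of_pos hJ]
  unfold neohookeanSlope
  linarith

/-! ### Integration of the bound and conclusion. -/

theorem IsHomeoOnto.image_eq {X Y : Set ℂ} {h : ℂ → ℂ} (hh : IsHomeoOnto X Y h) :
    h '' X = Y := by
  obtain ⟨e, he⟩ := hh
  ext y
  constructor
  · rintro ⟨x, hx, rfl⟩
    exact he ⟨x, hx⟩ ▸ (e ⟨x, hx⟩).2
  · intro hy
    exact ⟨e.symm ⟨y, hy⟩, (e.symm ⟨y, hy⟩).2, by simp [← he]⟩

theorem IsHomeoOnto.continuousOn {X Y : Set ℂ} {h : ℂ → ℂ} (hh : IsHomeoOnto X Y h) :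
    ContinuousOn h X := by
  obtain ⟨e, he⟩ := hh
  rw [continuousOn_iff_continuous_domRestrict]
  convert continuous_subtype_val.comp e.continuous using 1
  ext x : 1
  exact (he x).symm

/-- The area inequality for Sobolev homeomorphisms with exponent at least `2`. -/
theorem SobolevHomeo.volume_le_lintegral_abs_det {p : ℝ} (hp : 2 ≤ p) {X Y : Set ℂ}
    (hX : IsBoundedDomain X) {h : ℂ → ℂ} (hh : h ∈ SobolevHomeo p X Y) :
    volume Y ≤ ∫⁻ x in X, ENNReal.ofReal |(weakDeriv X h x).det| := by
  obtain ⟨hhomeo, ho, hLp, G, hG, hGp⟩ := hh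
  have : IsFiniteMeasure (volume.restrict X) := ⟨by simpa using hX.volume_ne_top.lt_top⟩
  have hW := hG.weakDeriv
  have h2p : (2 : ℝ≥0∞) ≤ ENNReal.ofReal p := by
    simpa using ENNReal.ofReal_le_ofReal hp
  have h1p : (1 : ℝ≥0∞) ≤ ENNReal.ofReal p := one_le_two.trans h2p
  have hWp : MemLp (weakDeriv X h) (ENNReal.ofReal p) (volume.restrict X) :=
    hGp.ae_eq (hG.ae_eq hX.isOpen hW)
  have hW2 : ∫⁻ x in X, ‖weakDeriv X h x‖ₑ ^ 2 ≠ ⊤ := by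
    have := lintegral_rpow_enorm_lt_top_of_eLpNorm_lt_top two_ne_zero ENNReal.ofNat_ne_top
      (hWp.mono_exponent h2p).2
    simpa using this.ne
  rw [← hhomeo.image_eq]
  exact ho.volume_image_le hX.isOpen hhomeo.continuousOn hW
    (memLp_one_iff_integrable.1 (hLp.mono_exponent h1p))
    (memLp_one_iff_integrable.1 (hWp.mono_exponent h1p)) hW2

theorem SobolevHomeo.le_neohookeanEnergy {p : ℝ} (hp : 2 ≤ p) {X : Set ℂ}
    (hX : IsBoundedDomain X) {h : ℂ → ℂ} (hh : h ∈ SobolevHomeo p X X) :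
    ENNReal.ofReal (2 ^ (p / 2) + 1) * volume X ≤ neohookeanEnergy p 1 X h := by
  set a := ENNReal.ofReal (neohookeanSlope p) with ha
  have hfin : a * volume X ≠ ⊤ := ENNReal.mul_ne_top ENNReal.ofReal_ne_top hX.volume_ne_top
  have key := lintegral_mono (μ := volume.restrict X)
    fun z => tangent_le_energy_density hp (weakDeriv X h z)
  rw [lintegral_add_left measurable_const, lintegral_add_left measurable_const,
    lintegral_const_mul' _ _ ENNReal.ofReal_ne_top, setLIntegral_const, setLIntegral_const] at key
  -- The slope term is kept on both sides to avoid truncated subtraction; it cancels because X has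
  -- finite area.
  refine (ENNReal.add_le_add_iff_left hfin).1 (le_trans ?_ key)
  rw [add_comm]
  gcongr
  exact SobolevHomeo.volume_le_lintegral_abs_det hp hX hh

theorem mainTheorem8 (p : ℝ) (hp : 2 ≤ p) (X : Set ℂ) (hX : IsBoundedDomain X) :
    id ∈ SobolevHomeo p X X ∧
    IsMinOn (neohookeanEnergy p 1 X) (SobolevHomeo p X X) id ∧
    (∀ h ∈ SobolevHomeo p X X,
      ENNReal.ofReal (2 ^ (p / 2) + 1) * volume X ≤ neohookeanEnergy p 1 X h) ∧
    neohookeanEnergy p 1 X id = ENNReal.ofReal (2 ^ (p / 2) + 1) * volume X := by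
  have hid := neohookeanEnergy_id hX.isOpen p
  have hle : ∀ h ∈ SobolevHomeo p X X,
      ENNReal.ofReal (2 ^ (p / 2) + 1) * volume X ≤ neohookeanEnergy p 1 X h :=
    fun h hh => SobolevHomeo.le_neohookeanEnergy hp hX hh
  exact ⟨⟨isHomeoOnto_id X, preservesOrientation_id X, hX.memSobolev_id p⟩,
    isMinOn_iff.2 fun h hh => hid ▸ hle h hh, hle, hid⟩
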